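/- Let $\nu\ge 1$ be an integer and let $h:[0,2\pi]^\nu\to\mathbb R$ be a function of class $C^{3\nu+3}$ (up to the boundary of the cube) which is separable, $h(\theta_1,\dots,\theta_\nu)=\sum_{j=1}^\nu h_j(\theta_j)$, where for each $j$ the set of critical points $\{x\in[0,2\pi]: h_j'(x)=0\}$ is finite (one-sided derivatives at $0$ and $2\pi$). No periodicity is assumed. Let $d\sigma(\theta)=\prod_{j=1}^\nu \frac{d\theta_j}{2\pi}$ on $[0,2\pi]^\nu$, and let $H_0$ be the bounded self-adjoint operator on $\ell^2(\mathbb Z^\nu)$ given by $$(H_0u)(n)=\int_{[0,2\pi]^\nu} h(\theta)\,e^{-i n\cdot\theta}\,\widehat u(\theta)\,d\sigma(\theta),$$ where $\widehat u\in L^2([0,2\pi]^\nu,\sigma)$ is the function whose Fourier coefficients are $\int e^{-in\cdot\theta}\,\widehat u(\theta)\,d\sigma(\theta)=u(n)$. Let $\mathbb Z_+=\{0,1,2,\dots\}$, let $\Delta_+$ be the operator on $\ell^2(\mathbb Z_+)$ given by $(\Delta_+u)(0)=u(1)$ and $(\Delta_+u)(n)=u(n+1)+u(n-1)$ for $n>0$,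 and let $$H_{0+}=\Delta_+\otimes I+I\otimes H_0\quad\text{on } \ell^2(\mathbb Z_+\times\mathbb Z^\nu).$$ Put $E_+=\sum_{j=1}^\nu\sup_{\theta\in[0,2\pi]}h_j(\theta)$ and $E_-=\sum_{j=1}^\nu\inf_{\theta\in[0,2\pi]}h_j(\theta)$. Then the spectra of $H_0$ and $H_{0+}$ are purely absolutely continuous (that is, for every vector $\psi$ the spectral measure of the operator at $\psi$ is absolutely continuous with respect to Lebesgue measure), and $$\sigma(H_0)=[E_-,E_+],\qquad \sigma(H_{0+})\supset[-2+E_-,\,2+E_+].$$ -/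

import Mathlib

open scoped ENNReal

noncomputable section

namespace HalfSpaceModel

/-! ### Purely absolutely continuous spectrum -/

section Spectral

variable {E : Type*} [NormedAddCommGroup E] [InnerProductSpace ℂ E] [CompleteSpace E]

/-- `μ` is the spectral measure of the bounded self-adjoint operator `A` at the vector `ψ`: the
finite Borel measure on `ℝ` with `⟨ψ, f(A) ψ⟩ = ∫ f dμ` for all bounded continuous `f : ℝ → ℝ`,
where `f(A)` is given by the continuous functional calculus. -/
def IsSpectralMeasure (A : E →L[ℂ] E) (ψ : E) (μ : MeasureTheory.Measure ℝ) : Prop :=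
  MeasureTheory.IsFiniteMeasure μ ∧
    ∀ f : BoundedContinuousFunction ℝ ℝ,
      inner ℂ ψ (cfc (fun x : ℝ => f x) A ψ) = ((∫ x, f x ∂μ : ℝ) : ℂ)

/-- The bounded operator `A` is self-adjoint and its spectrum is purely absolutely continuous:
the spectral measure of every vector is absolutely continuous with respect to Lebesgue measure
(no point part and no singular continuous part). -/
def HasPurelyACSpectrum (A : E →L[ℂ] E) : Prop :=
  IsSelfAdjoint A ∧
    ∀ ψ : E, ∃ μ : MeasureTheory.Measure ℝ,
      IsSpectralMeasure A ψ μ ∧ μ.AbsolutelyContinuous MeasureTheory.volume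

end Spectral

/-! ### The space `ℓ²` and operators on it -/

/-- The Hilbert space `ℓ²(ι)` of square summable complex families. -/
abbrev ell2 (ι : Type*) : Type _ := lp (fun _ : ι => ℂ) 2

theorem summable_sq {ι : Type*} (u : ell2 ι) : Summable fun i => ‖u i‖ ^ 2 := by
  simpa using (lp.memℓp u).summable (by norm_num)

theorem memℓp_of_summable_sq {ι : Type*} {f : ι → ℂ} (hf : Summable fun i => ‖f i‖ ^ 2) :
    Memℓp f 2 :=
  memℓp_gen (by simpa using hf)

theorem norm_sq_eq_tsum {ι : Type*} (u : ell2 ι) : ‖u‖ ^ 2 = ∑' i, ‖u i‖ ^ 2 := by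
  simpa using lp.norm_rpow_eq_tsum (p := 2) (by norm_num) u

/-- Composition with an injective map `e : ι → κ`, as a bounded operator `ℓ²(κ) → ℓ²(ι)`:
`(comp e u) i = u (e i)`. -/
def comp {ι κ : Type*} (e : ι → κ) (he : Function.Injective e) : ell2 κ →L[ℂ] ell2 ι :=
  LinearMap.mkContinuous
    { toFun := fun u => ⟨fun i => u (e i),
        memℓp_of_summable_sq ((summable_sq u).comp_injective he)⟩
      map_add' := fun _ _ => rfl
      map_smul' := fun _ _ => rfl } 1 (by
    intro u
    rw [one_mul]
    refine le_of_sq_le_sq ?_ (norm_nonneg _)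
    rw [norm_sq_eq_tsum, norm_sq_eq_tsum]
    exact tsum_comp_le_tsum_of_inj (summable_sq u) (fun _ => sq_nonneg _) he)

@[simp]
theorem comp_apply {ι κ : Type*} (e : ι → κ) (he : Function.Injective e) (u : ell2 κ) (i : ι) :
    comp e he u i = u (e i) := rfl

/-- The slice `u(a, ·)` of an element `u` of `ℓ²(α × β)`. -/
def slice {α β : Type*} (a : α) : ell2 (α × β) →L[ℂ] ell2 β :=
  comp (fun b => (a, b)) (Prod.mk_right_injective a)

@[simp]
theorem slice_apply {α β : Type*} (a : α) (u : ell2 (α × β)) (b : β) : slice a u b = u (a, b) := rfl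

theorem norm_sq_eq_tsum_slice {α β : Type*} (u : ell2 (α × β)) :
    (Summable fun a => ‖slice a u‖ ^ 2) ∧ ‖u‖ ^ 2 = ∑' a, ‖slice a u‖ ^ 2 := by
  have h := summable_sq u
  simp only [norm_sq_eq_tsum, slice_apply]
  exact ⟨h.prod, h.tsum_prod⟩

theorem summable_sq_fiber {α β : Type*} (A : ell2 β →L[ℂ] ell2 β) (u : ell2 (α × β)) :
    Summable fun p : α × β => ‖A (slice p.1 u) p.2‖ ^ 2 := by
  rw [summable_prod_of_nonneg (fun _ => sq_nonneg _)]
  refine ⟨fun a => summable_sq (A (slice a u)), ?_⟩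
  simp only [← norm_sq_eq_tsum]
  refine Summable.of_nonneg_of_le (fun _ => sq_nonneg _) (fun a => ?_)
    ((norm_sq_eq_tsum_slice u).1.mul_left (‖A‖ ^ 2))
  rw [← mul_pow]
  exact pow_le_pow_left₀ (norm_nonneg _) (A.le_opNorm _) 2

/-- The operator `I ⊗ A` on `ℓ²(α × β)`, for a bounded operator `A` on `ℓ²(β)`:
`((I ⊗ A) u)(a, b) = (A (u(a, ·)))(b)`. -/
def idTensor (α : Type*) {β : Type*} (A : ell2 β →L[ℂ] ell2 β) :
    ell2 (α × β) →L[ℂ] ell2 (α × β) :=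
  LinearMap.mkContinuous
    { toFun := fun u => ⟨fun p => A (slice p.1 u) p.2,
        memℓp_of_summable_sq (summable_sq_fiber A u)⟩
      map_add' := fun u v => by ext p; simp only [map_add]; rfl
      map_smul' := fun c u => by ext p; simp only [map_smul]; rfl } ‖A‖ (by
    intro u
    refine le_of_sq_le_sq ?_ (by positivity)
    rw [norm_sq_eq_tsum, mul_pow, (norm_sq_eq_tsum_slice u).2, ← tsum_mul_left]
    refine ((summable_sq_fiber A u).tsum_prod).trans_le ?_
    refine (summable_sq_fiber A u).prod.tsum_le_tsum (fun a => ?_)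
      ((norm_sq_eq_tsum_slice u).1.mul_left (‖A‖ ^ 2))
    rw [← mul_pow]
    refine (norm_sq_eq_tsum (A (slice a u))).symm.trans_le ?_
    exact pow_le_pow_left₀ (norm_nonneg _) (A.le_opNorm _) 2)

@[simp]
theorem idTensor_apply {α β : Type*} (A : ell2 β →L[ℂ] ell2 β) (u : ell2 (α × β)) (p : α × β) :
    idTensor α A u p = A (slice p.1 u) p.2 := rfl

/-- The operator `u ↦ u(n + 1, b)` on `ℓ²(ℕ × β)`. -/
def shiftDown (β : Type*) : ell2 (ℕ × β) →L[ℂ] ell2 (ℕ × β) :=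
  comp (fun p : ℕ × β => (p.1 + 1, p.2)) (fun p q h => by
    simp only [Prod.mk.injEq, add_left_inj] at h
    exact Prod.ext h.1 h.2)

/-- The half-line Laplacian acting on the first variable, that is `Δ₊ ⊗ I` on `ℓ²(ℕ × β)`:
the sum of the shift `u(n + 1, b)` and of its adjoint. The formulas defining it pointwise are
`halfLaplacian_zero` and `halfLaplacian_succ`. -/
def halfLaplacian (β : Type*) : ell2 (ℕ × β) →L[ℂ] ell2 (ℕ × β) :=
  shiftDown β + (shiftDown β).adjoint

theorem shiftDown_apply {β : Type*} (u : ell2 (ℕ × β)) (n : ℕ) (b : β) :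
    shiftDown β u (n, b) = u (n + 1, b) := rfl

theorem adjoint_shiftDown_apply {β : Type*} (u : ell2 (ℕ × β)) (p : ℕ × β) :
    (shiftDown β).adjoint u p = if p.1 = 0 then 0 else u (p.1 - 1, p.2) := by
  classical
  have key : ∀ (κ : Type _) [DecidableEq κ] (v : ell2 κ) (q : κ),
      inner ℂ (lp.single 2 q (1 : ℂ) : ell2 κ) v = v q := by
    intro κ _ v q
    rw [lp.inner_single_left]
    simp
  rw [← key, ContinuousLinearMap.adjoint_inner_right]
  obtain ⟨n, b⟩ := p
  rcases n with _ | n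
  · have : shiftDown β (lp.single 2 ((0 : ℕ), b) (1 : ℂ)) = 0 := by
      ext ⟨m, c⟩
      rw [shiftDown_apply, lp.single_apply_ne]
      · rfl
      · simp
    rw [this]
    simp
  · have : shiftDown β (lp.single 2 (n + 1, b) (1 : ℂ)) = lp.single 2 (n, b) (1 : ℂ) := by
      ext ⟨m, c⟩
      rw [shiftDown_apply]
      simp only [lp.single_apply, Pi.single_apply, Prod.mk.injEq, add_left_inj]
    rw [this, key]
    simp

theorem halfLaplacian_zero {β : Type*} (u : ell2 (ℕ × β)) (b : β) :
    halfLaplacian β u (0, b) = u (1, b) := by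
  change shiftDown β u (0, b) + (shiftDown β).adjoint u (0, b) = _
  rw [shiftDown_apply, adjoint_shiftDown_apply]
  simp

theorem halfLaplacian_succ {β : Type*} (u : ell2 (ℕ × β)) (n : ℕ) (b : β) :
    halfLaplacian β u (n + 1, b) = u (n + 2, b) + u (n, b) := by
  change shiftDown β u (n + 1, b) + (shiftDown β).adjoint u (n + 1, b) = _
  rw [shiftDown_apply, adjoint_shiftDown_apply]
  simp

/-! ### Fourier multipliers on `ℓ²(ℤ^ν)` -/

/-- The interval `[0, 2π]`. -/
def circleInterval : Set ℝ := Set.Icc 0 (2 * Real.pi)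

/-- The cube `[0, 2π]^ν`. -/
def cube (ν : ℕ) : Set (Fin ν → ℝ) := {θ | ∀ j, θ j ∈ circleInterval}

/-- The normalized Haar measure on the torus `(ℝ/ℤ)^ν`. In the angles `θ = 2πt` it is
`∏ dθ_j / 2π` on `[0, 2π]^ν`. -/
abbrev torusMeasure (ν : ℕ) : MeasureTheory.Measure (UnitAddTorus (Fin ν)) :=
  MeasureTheory.Measure.pi fun _ => AddCircle.haarAddCircle

/-- The Hilbert space `L²` of the torus. -/
abbrev L2Torus (ν : ℕ) : Type := MeasureTheory.Lp ℂ 2 (torusMeasure ν)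

/-- The Fourier transform `L²(𝕋^ν) → ℓ²(ℤ^ν)`, sending a function to its Fourier coefficients. -/
def fourierTransform (ν : ℕ) : L2Torus ν ≃ₗᵢ[ℂ] ell2 (Fin ν → ℤ) :=
  UnitAddTorus.mFourierBasis.repr

/-- The angles `θ ∈ [0, 2π)^ν` of a point of `(ℝ/ℤ)^ν`. -/
def angles {ν : ℕ} (t : UnitAddTorus (Fin ν)) : Fin ν → ℝ :=
  fun j => 2 * Real.pi * (AddCircle.equivIco 1 0 (t j) : ℝ)

theorem angles_mem_cube {ν : ℕ} (t : UnitAddTorus (Fin ν)) : angles t ∈ cube ν := by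
  intro j
  have h := (AddCircle.equivIco 1 0 (t j)).2
  have hpi := Real.pi_pos
  refine ⟨mul_nonneg (by positivity) h.1, ?_⟩
  have h2 : (AddCircle.equivIco 1 0 (t j) : ℝ) ≤ 1 := by linarith [h.2]
  change 2 * Real.pi * (AddCircle.equivIco 1 0 (t j) : ℝ) ≤ 2 * Real.pi
  nlinarith

theorem measurable_angles {ν : ℕ} : Measurable (angles (ν := ν)) := by
  refine measurable_pi_lambda _ fun j => ?_
  refine Measurable.const_mul ?_ _
  exact measurable_subtype_coe.comp
    ((AddCircle.measurableEquivIco 1 0).measurable.comp (measurable_pi_apply j))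

theorem isCompact_cube (ν : ℕ) : IsCompact (cube ν) := by
  have : cube ν = Set.pi Set.univ fun _ => circleInterval := by
    ext; simp [cube]
  rw [this]
  exact isCompact_univ_pi fun _ => isCompact_Icc

/-- The function `h` on the cube, viewed as a function on the torus. -/
def symbol {ν : ℕ} (h : (Fin ν → ℝ) → ℝ) (t : UnitAddTorus (Fin ν)) : ℂ := (h (angles t) : ℂ)

theorem memLp_symbol {ν : ℕ} {h : (Fin ν → ℝ) → ℝ} (hh : ContinuousOn h (cube ν)) :
    MeasureTheory.MemLp (symbol h) ∞ (torusMeasure ν) := by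
  obtain ⟨C, hC⟩ := (isCompact_cube ν).exists_bound_of_continuousOn hh
  refine MeasureTheory.memLp_top_of_bound (C := C) ?_ (Filter.Eventually.of_forall fun t => ?_)
  · have h1 : Measurable fun t : UnitAddTorus (Fin ν) =>
        (⟨angles t, angles_mem_cube t⟩ : cube ν) := measurable_angles.subtype_mk
    have h2 : Measurable ((cube ν).domRestrict h) := hh.domRestrict.measurable
    exact (Complex.measurable_ofReal.comp (h2.comp h1)).aestronglyMeasurable
  · simpa [symbol] using hC _ (angles_mem_cube t)

/-- The operator of multiplication by `h` on `L²(𝕋^ν)`, for `h` continuous on the cube. -/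
def mulOperator {ν : ℕ} (h : (Fin ν → ℝ) → ℝ) (hh : ContinuousOn h (cube ν)) :
    L2Torus ν →L[ℂ] L2Torus ν :=
  (ContinuousLinearMap.mul ℂ ℂ).holderL (torusMeasure ν) ∞ 2 2 ((memLp_symbol hh).toLp (symbol h))

theorem mulOperator_apply {ν : ℕ} (h : (Fin ν → ℝ) → ℝ) (hh : ContinuousOn h (cube ν))
    (f : L2Torus ν) :
    mulOperator h hh f =ᵐ[torusMeasure ν] fun t => (h (angles t) : ℂ) * f t := by
  refine ((ContinuousLinearMap.mul ℂ ℂ).coeFn_holder _ f).trans ?_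
  filter_upwards [(memLp_symbol hh).coeFn_toLp] with t ht
  rw [ht]
  rfl

/-- The operator `H₀` on `ℓ²(ℤ^ν)`: the Fourier multiplier with symbol `h`,
`(H₀ u)(n) = ∫ h(θ) e^{-i n·θ} û(θ) dσ(θ)`, where `u(n)` are the Fourier coefficients of `û`. -/
def H0 {ν : ℕ} (h : (Fin ν → ℝ) → ℝ) (hh : ContinuousOn h (cube ν)) :
    ell2 (Fin ν → ℤ) →L[ℂ] ell2 (Fin ν → ℤ) :=
  (fourierTransform ν).toContinuousLinearEquiv.toContinuousLinearMap ∘L mulOperator h hh ∘L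
    (fourierTransform ν).symm.toContinuousLinearEquiv.toContinuousLinearMap

theorem fourierTransform_apply {ν : ℕ} (f : L2Torus ν) (n : Fin ν → ℤ) :
    fourierTransform ν f n = ∫ t, UnitAddTorus.mFourier (-n) t * f t ∂(torusMeasure ν) :=
  UnitAddTorus.mFourierBasis_repr f n

theorem H0_apply {ν : ℕ} (h : (Fin ν → ℝ) → ℝ) (hh : ContinuousOn h (cube ν))
    (u : ell2 (Fin ν → ℤ)) (n : Fin ν → ℤ) :
    H0 h hh u n = ∫ t, UnitAddTorus.mFourier (-n) t *
      ((h (angles t) : ℂ) * (fourierTransform ν).symm u t) ∂(torusMeasure ν) := by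
  refine (fourierTransform_apply _ n).trans (MeasureTheory.integral_congr_ae ?_)
  filter_upwards [mulOperator_apply h hh ((fourierTransform ν).symm u)] with t ht
  exact congrArg _ ht

/-- In the angles `θ` the character `mFourier (-n)` is `e^{-i n·θ}`. -/
theorem mFourier_neg_eq {ν : ℕ} (n : Fin ν → ℤ) (t : UnitAddTorus (Fin ν)) :
    UnitAddTorus.mFourier (-n) t =
      Complex.exp (-Complex.I * ∑ j, (n j : ℂ) * (angles t j : ℂ)) := by
  rw [Finset.mul_sum, Complex.exp_sum]
  change (∏ j, fourier ((-n) j) (t j) : ℂ) = _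
  refine Finset.prod_congr rfl fun j _ => ?_
  have : t j = ((AddCircle.equivIco 1 0 (t j) : ℝ) : UnitAddCircle) :=
    ((AddCircle.equivIco 1 0).symm_apply_apply (t j)).symm
  conv_lhs => rw [this]
  rw [fourier_coe_apply]
  congr 1
  simp only [angles, Pi.neg_apply]
  push_cast
  ring

/-- The half-space operator `H₀₊ = Δ₊ ⊗ I + I ⊗ H₀` on `ℓ²(ℤ₊ × ℤ^ν)`, `ℤ₊ = {0, 1, 2, …}`. -/
def H0plus {ν : ℕ} (h : (Fin ν → ℝ) → ℝ) (hh : ContinuousOn h (cube ν)) :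
    ell2 (ℕ × (Fin ν → ℤ)) →L[ℂ] ell2 (ℕ × (Fin ν → ℤ)) :=
  halfLaplacian (Fin ν → ℤ) + idTensor ℕ (H0 h hh)

/-- `E₊`, the sum of the suprema of the `h_j` over `[0, 2π]`. -/
def Eplus {ν : ℕ} (hj : Fin ν → ℝ → ℝ) : ℝ := ∑ j, sSup (hj j '' circleInterval)

/-- `E₋`, the sum of the infima of the `h_j` over `[0, 2π]`. -/
def Eminus {ν : ℕ} (hj : Fin ν → ℝ → ℝ) : ℝ := ∑ j, sInf (hj j '' circleInterval)

/-- The critical points of `g` in `[0, 2π]` (one-sided derivatives at the end points). -/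
def criticalSet (g : ℝ → ℝ) : Set ℝ :=
  {x | x ∈ circleInterval ∧ derivWithin g circleInterval x = 0}

end HalfSpaceModel

end

/-!
The operator `H₀` is unitarily equivalent to multiplication by the symbol `h` on `L²` of the torus.
Its spectral measure at `u` is the image under `h` of `|û|² dσ`, as one sees by comparing moments
(`isSpectralMeasure_of_moments`), and its spectrum is the range of `h` on the closed cube
(`spectrum_H0`), which is `[E₋, E₊]` because the cube is compact and connected. Absolute continuity
therefore amounts to `h` pulling null sets back to null sets. By Fubini it is enough that one of the
summands `h_j` does so (`torusMeasure_preimage_eq_zero`), and a `C¹` function with finitely many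
critical points does, being locally a diffeomorphism away from them (`volume_preimage_eq_zero`).

The half-space operator `H₀₊` is compared with the bulk operator on `ℓ²(ℤ^{ν+1})`, the multiplier
with symbol `2 cos θ₀ + h(θ₁, …, θ_ν)`, to which all of the above applies. For the spectral measures,
the reflection principle: the odd extension of sequences in the first variable is a multiple of an
isometry and intertwines `H₀₊` with the bulk operator (`oddExtension_H0plus`), so that the spectral
measures of `H₀₊` are half of those of the bulk operator at odd vectors. For the spectrum: truncating
a vector of the whole space to `n ≥ -N` changes the action of the Hamiltonian only by the layer
`-N - 1` of the vector, which tends to `0` as `N → ∞`. Hence if `H₀₊ - z` is bounded below, so is the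
bulk operator minus `z` (`norm_le_bulk_of_norm_le_halfSpace`), and the spectrum of `H₀₊` contains the
range `[-2 + E₋, 2 + E₊]` of the bulk symbol.
-/

noncomputable section

namespace HalfSpaceModel

open MeasureTheory

/-! ### Spectral measures from moments -/

section Moments

variable {E : Type*} [NormedAddCommGroup E] [InnerProductSpace ℂ E]

theorem inner_aeval_eq_integral_of_moments {A : E →L[ℂ] E} {ψ : E} {μ : Measure ℝ}
    (hint : ∀ n : ℕ, Integrable (fun x : ℝ => x ^ n) μ)
    (hmom : ∀ n : ℕ, inner ℂ ψ ((A ^ n) ψ) = ((∫ x, x ^ n ∂μ : ℝ) : ℂ)) (q : Polynomial ℝ) :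
    Integrable (fun x => q.eval x) μ ∧
      inner ℂ ψ (Polynomial.aeval A q ψ) = ((∫ x, q.eval x ∂μ : ℝ) : ℂ) := by
  induction q using Polynomial.induction_on' with
  | add p q hp hq =>
    refine ⟨(hp.1.add hq.1).congr (.of_forall fun x => by simp), ?_⟩
    simp only [map_add, Polynomial.eval_add, add_apply, inner_add_right]
    rw [integral_add hp.1 hq.1, hp.2, hq.2, Complex.ofReal_add]
  | monomial n c =>
    refine ⟨by simpa using (hint n).const_mul c, ?_⟩
    simp only [Polynomial.aeval_monomial, Polynomial.eval_monomial]
    rw [integral_const_mul, Complex.ofReal_mul, ← hmom n, ← Algebra.smul_def]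
    change inner ℂ ψ ((c : ℝ) • (A ^ n) ψ) = _
    rw [inner_smul_right_eq_smul, Complex.real_smul]

/-- A finite measure on a compact interval with the same moments as the self-adjoint operator `A`
at `ψ` is the spectral measure, because polynomials are dense in the continuous functions on a
compact interval containing the measure and the spectrum of `A`. -/
theorem isSpectralMeasure_of_moments [CompleteSpace E] {A : E →L[ℂ] E} (hA : IsSelfAdjoint A) {ψ : E}
    {μ : Measure ℝ} [IsFiniteMeasure μ] {R : ℝ} (hR : ∀ᵐ x ∂μ, |x| ≤ R)
    (hmom : ∀ n : ℕ, inner ℂ ψ ((A ^ n) ψ) = ((∫ x, x ^ n ∂μ : ℝ) : ℂ)) :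
    IsSpectralMeasure A ψ μ := by
  refine ⟨inferInstance, fun f => ?_⟩
  have hint : ∀ n : ℕ, Integrable (fun x : ℝ => x ^ n) μ := fun n => by
    refine Integrable.of_bound (by fun_prop) (R ^ n) ?_
    filter_upwards [hR] with x hx
    rw [norm_pow]
    exact pow_le_pow_left₀ (norm_nonneg _) hx n
  set T : ℝ := max R (‖A‖ * ‖(1 : E →L[ℂ] E)‖) with hT
  have hclose : ∀ ε > 0, ‖inner ℂ ψ (cfc (fun x : ℝ => f x) A ψ) - ((∫ x, f x ∂μ : ℝ) : ℂ)‖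
      ≤ ε * (‖ψ‖ ^ 2 + μ.real Set.univ) := by
    intro ε hε
    obtain ⟨p, hp⟩ := exists_polynomial_near_of_continuousOn (-T) T (fun x => f x)
      f.continuous.continuousOn ε hε
    obtain ⟨hpi, hpm⟩ := inner_aeval_eq_integral_of_moments hint hmom p
    have h1 : ‖cfc (fun x : ℝ => f x) A - Polynomial.aeval A p‖ ≤ ε := by
      rw [← cfc_polynomial p A, ← cfc_sub (fun x : ℝ => f x) (fun x => p.eval x) A
        f.continuous.continuousOn p.continuous.continuousOn]
      refine norm_cfc_le hε.le fun x hx => ?_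
      have hx' : |x| ≤ T := (spectrum.norm_le_norm_mul_of_mem hx).trans (le_max_right _ _)
      rw [norm_sub_rev]
      exact (hp x (abs_le.1 hx')).le
    have h2 : ‖inner ℂ ψ (cfc (fun x : ℝ => f x) A ψ) - inner ℂ ψ (Polynomial.aeval A p ψ)‖
        ≤ ε * ‖ψ‖ ^ 2 := by
      rw [← inner_sub_right, ← sub_apply]
      refine (norm_inner_le_norm _ _).trans ?_
      refine (mul_le_mul_of_nonneg_left ((ContinuousLinearMap.le_opNorm _ _).trans
        (mul_le_mul_of_nonneg_right h1 (norm_nonneg _))) (norm_nonneg _)).trans_eq (by ring)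
    have h3 : ‖((∫ x, p.eval x ∂μ : ℝ) : ℂ) - ((∫ x, f x ∂μ : ℝ) : ℂ)‖ ≤ ε * μ.real Set.univ := by
      rw [← Complex.ofReal_sub, Complex.norm_real, ← integral_sub hpi (f.integrable μ)]
      refine norm_integral_le_of_norm_le_const ?_
      filter_upwards [hR] with x hx
      exact (hp x (abs_le.1 (hx.trans (le_max_left _ _)))).le
    rw [hpm] at h2
    calc _ ≤ _ := norm_sub_le_norm_sub_add_norm_sub _ _ _
      _ ≤ _ := (add_le_add h2 h3).trans_eq (by ring)
  rw [← sub_eq_zero, ← norm_le_zero_iff]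
  refine le_of_forall_gt_imp_ge_of_dense fun δ hδ => ?_
  have hpos : 0 < ‖ψ‖ ^ 2 + μ.real Set.univ + 1 := by positivity
  refine (hclose (δ / (‖ψ‖ ^ 2 + μ.real Set.univ + 1)) (by positivity)).trans ?_
  rw [div_mul_eq_mul_div, div_le_iff₀ hpos]
  nlinarith

end Moments

/-! ### Algebra of the multipliers -/

section Multiplier

variable {ν : ℕ}

theorem H0_congr {h k : (Fin ν → ℝ) → ℝ} (hh : ContinuousOn h (cube ν))
    (hk : ContinuousOn k (cube ν)) (H : Set.EqOn h k (cube ν)) : H0 h hh = H0 k hk := by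
  have : mulOperator h hh = mulOperator k hk := by
    ext1 f
    refine Lp.ext ?_
    filter_upwards [mulOperator_apply h hh f, mulOperator_apply k hk f] with t h1 h2
    rw [h1, h2, H (angles_mem_cube t)]
  rw [H0, H0, this]

theorem symm_H0_apply (h : (Fin ν → ℝ) → ℝ) (hh : ContinuousOn h (cube ν))
    (u : ell2 (Fin ν → ℤ)) :
    (fourierTransform ν).symm (H0 h hh u) = mulOperator h hh ((fourierTransform ν).symm u) :=
  (fourierTransform ν).symm_apply_apply _

theorem symm_H0_apply_ae (h : (Fin ν → ℝ) → ℝ) (hh : ContinuousOn h (cube ν))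
    (u : ell2 (Fin ν → ℤ)) :
    (fourierTransform ν).symm (H0 h hh u) =ᵐ[torusMeasure ν]
      fun t => (h (angles t) : ℂ) * (fourierTransform ν).symm u t := by
  rw [symm_H0_apply]
  exact mulOperator_apply h hh _

theorem H0_mul {h k : (Fin ν → ℝ) → ℝ} (hh : ContinuousOn h (cube ν))
    (hk : ContinuousOn k (cube ν)) : H0 h hh * H0 k hk = H0 (h * k) (hh.mul hk) := by
  refine ContinuousLinearMap.ext fun u => (fourierTransform ν).symm.injective (Lp.ext ?_)
  filter_upwards [symm_H0_apply_ae h hh (H0 k hk u), symm_H0_apply_ae k hk u,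
    symm_H0_apply_ae _ (hh.mul hk) u] with t h1 h2 h3
  refine h1.trans ?_
  rw [h2, h3, Pi.mul_apply]
  push_cast
  ring

theorem H0_const (c : ℝ) :
    H0 (ν := ν) (fun _ => c) continuousOn_const = algebraMap ℂ _ (c : ℂ) := by
  refine ContinuousLinearMap.ext fun u => (fourierTransform ν).symm.injective (Lp.ext ?_)
  rw [Algebra.algebraMap_eq_smul_one]
  change _ =ᵐ[torusMeasure ν] (fourierTransform ν).symm ((c : ℂ) • u)
  rw [map_smul]
  filter_upwards [symm_H0_apply_ae (fun _ => c) continuousOn_const u,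
    Lp.coeFn_smul (c : ℂ) ((fourierTransform ν).symm u)] with t h1 h2
  rw [h1, h2]
  simp

theorem H0_eq_one {k : (Fin ν → ℝ) → ℝ} (hk : ContinuousOn k (cube ν))
    (h1 : ∀ θ ∈ cube ν, k θ = 1) : H0 k hk = 1 := by
  rw [H0_congr (k := fun _ => 1) hk continuousOn_const h1, H0_const]
  simp

theorem H0_sub {h k : (Fin ν → ℝ) → ℝ} (hh : ContinuousOn h (cube ν))
    (hk : ContinuousOn k (cube ν)) : H0 h hh - H0 k hk = H0 (h - k) (hh.sub hk) := by
  refine ContinuousLinearMap.ext fun u => (fourierTransform ν).symm.injective (Lp.ext ?_)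
  rw [sub_apply, map_sub]
  filter_upwards [Lp.coeFn_sub ((fourierTransform ν).symm (H0 h hh u))
    ((fourierTransform ν).symm (H0 k hk u)), symm_H0_apply_ae h hh u, symm_H0_apply_ae k hk u,
    symm_H0_apply_ae _ (hh.sub hk) u] with t h0 h1 h2 h3
  rw [h0, h3, Pi.sub_apply, Pi.sub_apply, h1, h2]
  push_cast
  ring

theorem H0_pow {h : (Fin ν → ℝ) → ℝ} (hh : ContinuousOn h (cube ν)) (n : ℕ) :
    H0 h hh ^ n = H0 (h ^ n) (hh.pow n) := by
  induction n with
  | zero =>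
    rw [pow_zero, H0_eq_one (k := h ^ 0) _ fun θ _ => pow_zero (h θ)]
  | succ n ih =>
    rw [pow_succ, ih, H0_mul]
    exact H0_congr _ _ fun θ _ => (pow_succ _ _).symm

theorem inner_H0_eq_integral {h : (Fin ν → ℝ) → ℝ} (hh : ContinuousOn h (cube ν))
    (v u : ell2 (Fin ν → ℤ)) :
    inner ℂ v (H0 h hh u) = ∫ t, (h (angles t) : ℂ) *
      inner ℂ ((fourierTransform ν).symm v t) ((fourierTransform ν).symm u t)
        ∂(torusMeasure ν) := by
  rw [← (fourierTransform ν).symm.inner_map_map, L2.inner_def]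
  refine integral_congr_ae ?_
  filter_upwards [symm_H0_apply_ae h hh u] with t ht
  rw [ht, ← smul_eq_mul, inner_smul_right]

theorem isSelfAdjoint_H0 {h : (Fin ν → ℝ) → ℝ} (hh : ContinuousOn h (cube ν)) :
    IsSelfAdjoint (H0 h hh) := by
  rw [ContinuousLinearMap.isSelfAdjoint_iff_isSymmetric]
  intro u v
  change inner ℂ (H0 h hh u) v = inner ℂ u (H0 h hh v)
  rw [← inner_conj_symm, inner_H0_eq_integral, inner_H0_eq_integral, ← integral_conj]
  refine integral_congr_ae (Filter.Eventually.of_forall fun t => ?_)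
  simp only [map_mul, Complex.conj_ofReal, inner_conj_symm]

theorem measurable_comp_angles {h : (Fin ν → ℝ) → ℝ} (hh : ContinuousOn h (cube ν)) :
    Measurable fun t : UnitAddTorus (Fin ν) => h (angles t) := by
  have h1 : Measurable fun t : UnitAddTorus (Fin ν) =>
      (⟨angles t, angles_mem_cube t⟩ : cube ν) := measurable_angles.subtype_mk
  have h2 : Measurable ((cube ν).domRestrict h) := hh.domRestrict.measurable
  exact h2.comp h1

/-- The spectral measure of `H₀` at `u` is the image under the symbol of the measure with density
`|û|²`; it is absolutely continuous as soon as the symbol pulls null sets back to null sets. -/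
theorem exists_isSpectralMeasure_H0 {h : (Fin ν → ℝ) → ℝ} (hh : ContinuousOn h (cube ν))
    (hnull : ∀ N : Set ℝ, volume N = 0 → torusMeasure ν {t | h (angles t) ∈ N} = 0)
    (u : ell2 (Fin ν → ℤ)) :
    ∃ (μ : Measure ℝ) (R : ℝ), IsFiniteMeasure μ ∧ (∀ᵐ x ∂μ, |x| ≤ R) ∧ μ ≪ volume ∧
      ∀ n : ℕ, inner ℂ u ((H0 h hh ^ n) u) = ((∫ x, x ^ n ∂μ : ℝ) : ℂ) := by
  have hmeas := measurable_comp_angles hh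
  obtain ⟨R, hR⟩ := (isCompact_cube ν).exists_bound_of_continuousOn hh
  set f : L2Torus ν := (fourierTransform ν).symm u with hf
  set ρ : Measure (UnitAddTorus (Fin ν)) :=
    (torusMeasure ν).withDensity fun t => ENNReal.ofReal (‖f t‖ ^ 2) with hρ
  have hfi : Integrable (fun t => ‖f t‖ ^ 2) (torusMeasure ν) := (Lp.memLp f).norm.integrable_sq
  have hfin : IsFiniteMeasure ρ := isFiniteMeasure_withDensity_ofReal hfi.2
  have hfm : AEMeasurable (fun t => ‖f t‖ ^ 2) (torusMeasure ν) := hfi.aemeasurable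
  refine ⟨ρ.map fun t => h (angles t), R, inferInstance, ?_, ?_, fun n => ?_⟩
  · rw [ae_map_iff hmeas.aemeasurable (measurableSet_le (by fun_prop) measurable_const)]
    exact Filter.Eventually.of_forall fun t => hR _ (angles_mem_cube t)
  · refine Measure.AbsolutelyContinuous.trans
      ((withDensity_absolutelyContinuous _ _).map hmeas) ?_
    refine Measure.AbsolutelyContinuous.mk fun N hN hN0 => ?_
    rw [Measure.map_apply hmeas hN]
    exact hnull N hN0
  · rw [integral_map hmeas.aemeasurable (by fun_prop), hρ,
      integral_withDensity_eq_integral_toReal_smul₀ hfm.ennreal_ofReal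
        (Filter.Eventually.of_forall fun _ => ENNReal.ofReal_lt_top), H0_pow, inner_H0_eq_integral,
      ← integral_complex_ofReal]
    refine integral_congr_ae (Filter.Eventually.of_forall fun t => ?_)
    simp only [Pi.pow_apply, inner_self_eq_norm_sq_to_K, ENNReal.toReal_ofReal (sq_nonneg ‖f t‖),
      smul_eq_mul, ← hf]
    push_cast
    exact mul_comm _ _

theorem hasPurelyACSpectrum_H0 {h : (Fin ν → ℝ) → ℝ} (hh : ContinuousOn h (cube ν))
    (hnull : ∀ N : Set ℝ, volume N = 0 → torusMeasure ν {t | h (angles t) ∈ N} = 0) :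
    HasPurelyACSpectrum (H0 h hh) := by
  refine ⟨isSelfAdjoint_H0 hh, fun u => ?_⟩
  obtain ⟨μ, R, hfin, hR, hac, hmom⟩ := exists_isSpectralMeasure_H0 hh hnull u
  exact ⟨μ, isSpectralMeasure_of_moments (isSelfAdjoint_H0 hh) hR hmom, hac⟩

end Multiplier

/-! ### Null sets under the symbol -/

/-- A `C¹` function with finitely many critical points pulls null sets back to null sets: away from
the critical points it is locally invertible, with a differentiable inverse, and differentiable
maps preserve null sets. -/
theorem volume_preimage_eq_zero {g : ℝ → ℝ} (hg : ContDiffOn ℝ 1 g circleInterval)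
    (hc : (criticalSet g).Finite) {N : Set ℝ} (hN : volume N = 0) :
    volume {x | x ∈ circleInterval ∧ g x ∈ N} = 0 := by
  set S : Set ℝ := {x | x ∈ Set.Ioo 0 (2 * Real.pi) ∧ x ∉ criticalSet g ∧ g x ∈ N} with hS
  have hsub : {x | x ∈ circleInterval ∧ g x ∈ N} ⊆
      (criticalSet g ∪ {0, 2 * Real.pi}) ∪ S := by
    rintro x ⟨hx, hxN⟩
    by_cases h1 : x ∈ criticalSet g
    · exact Or.inl (Or.inl h1)
    rcases Set.eq_endpoints_or_mem_Ioo_of_mem_Icc hx with h0 | h0 | h0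
    · exact Or.inl (Or.inr (by simp [h0]))
    · exact Or.inl (Or.inr (by simp [h0]))
    · exact Or.inr ⟨h0, h1, hxN⟩
  refine measure_mono_null hsub (measure_union_null
    ((hc.union (Set.toFinite _)).measure_zero volume) ?_)
  have hder : ∀ x ∈ S, HasStrictDerivAt g (deriv g x) x ∧ deriv g x ≠ 0 := by
    rintro x ⟨hx, hxc, -⟩
    have hmem : circleInterval ∈ nhds x := Icc_mem_nhds hx.1 hx.2
    refine ⟨(hg.contDiffAt hmem).hasStrictDerivAt one_ne_zero, fun h0 => hxc ?_⟩
    exact ⟨Set.Ioo_subset_Icc_self hx, by rw [derivWithin_of_mem_nhds hmem, h0]⟩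
  refine measure_null_of_locally_null S fun x hx => ?_
  obtain ⟨hsx, hnx⟩ := hder x hx
  set e := (hsx.hasStrictFDerivAt_equiv hnx).toOpenPartialHomeomorph g with he
  have heg : ∀ y, e y = g y := fun y => rfl
  have hxe : x ∈ e.source :=
    (hsx.hasStrictFDerivAt_equiv hnx).mem_toOpenPartialHomeomorph_source
  refine ⟨S ∩ e.source, Filter.inter_mem self_mem_nhdsWithin
    (mem_nhdsWithin_of_mem_nhds (e.open_source.mem_nhds hxe)), ?_⟩
  have hdiff : DifferentiableOn ℝ e.symm (g '' (S ∩ e.source)) := by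
    rintro _ ⟨y, ⟨hyS, hye⟩, rfl⟩
    have hinv : e.symm (g y) = y := by rw [← heg]; exact e.left_inv hye
    refine (e.hasDerivAt_symm (f' := deriv g y) (e.map_source hye) (hder y hyS).2
      ?_).differentiableAt.differentiableWithinAt
    rw [heg, hinv]
    exact (hder y hyS).1.hasDerivAt
  refine measure_mono_null (t := e.symm '' (g '' (S ∩ e.source)))
    (fun y hy => ⟨g y, ⟨y, hy, rfl⟩, e.left_inv hy.2⟩)
    (addHaar_image_eq_zero_of_differentiableOn_of_addHaar_eq_zero volume hdiff
      (measure_mono_null ?_ hN))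
  rintro _ ⟨y, hy, rfl⟩
  exact hy.1.2.2

/-- The angle in `[0, 2π)` of a point of `ℝ/ℤ`. -/
def angle (t : UnitAddCircle) : ℝ := 2 * Real.pi * (AddCircle.equivIco 1 0 t : ℝ)

theorem angles_apply {ν : ℕ} (t : UnitAddTorus (Fin ν)) (j : Fin ν) :
    angles t j = angle (t j) := rfl

theorem angle_mem (t : UnitAddCircle) : angle t ∈ circleInterval :=
  angles_mem_cube (ν := 1) (fun _ => t) 0

theorem measurable_angle : Measurable angle :=
  (measurable_subtype_coe.comp (AddCircle.measurableEquivIco 1 0).measurable).const_mul _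

theorem measurable_comp_angle {g : ℝ → ℝ} (hg : ContinuousOn g circleInterval) :
    Measurable fun t => g (angle t) :=
  (hg.domRestrict.measurable : Measurable (circleInterval.domRestrict g)).comp
    (measurable_angle.subtype_mk (h := angle_mem))

theorem angle_coe {x : ℝ} (hx : x ∈ Set.Ico (0 : ℝ) 1) :
    angle (x : UnitAddCircle) = 2 * Real.pi * x := by
  rw [angle, AddCircle.coe_equivIco_mk_apply]
  simp [Int.fract_eq_self.2 hx]

theorem haar_preimage_angle_eq_zero {g : ℝ → ℝ} (hg : ContinuousOn g circleInterval) {N : Set ℝ}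
    (hNm : MeasurableSet N) (hN : volume {x | x ∈ circleInterval ∧ g x ∈ N} = 0) :
    AddCircle.haarAddCircle {t : UnitAddCircle | g (angle t) ∈ N} = 0 := by
  have hm : MeasurableSet {t : UnitAddCircle | g (angle t) ∈ N} := measurable_comp_angle hg hNm
  have hvol : (volume : Measure UnitAddCircle) = AddCircle.haarAddCircle := by
    rw [AddCircle.volume_eq_smul_haarAddCircle]
    simp
  rw [← hvol, ← (UnitAddCircle.measurePreserving_mk 0).measure_preimage hm.nullMeasurableSet,
    Measure.restrict_apply ((UnitAddCircle.measurePreserving_mk 0).measurable hm)]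
  refine measure_mono_null (t := {1} ∪ (fun x => 2 * Real.pi * x) ⁻¹'
    {x | x ∈ circleInterval ∧ g x ∈ N}) ?_ (measure_union_null (by simp) ?_)
  · rintro x ⟨hx, hx0, hx1⟩
    rw [zero_add] at hx1
    rcases hx1.eq_or_lt with h1 | h1
    · exact Or.inl h1
    · have := angle_coe ⟨hx0.le, h1⟩
      refine Or.inr ?_
      rw [Set.mem_preimage, ← this]
      exact ⟨angle_mem _, hx⟩
  · rw [Real.volume_preimage_mul_left (by positivity), hN, mul_zero]

/-- If the symbol is the sum of a function of one angle which pulls null sets back to null sets,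
and of any function of the other angles, then it pulls null sets back to null sets, by Fubini. -/
theorem torusMeasure_preimage_eq_zero {ν : ℕ} {h : (Fin (ν + 1) → ℝ) → ℝ}
    (hh : ContinuousOn h (cube (ν + 1))) {g : ℝ → ℝ} (hg : ContinuousOn g circleInterval)
    (c : (Fin ν → ℝ) → ℝ)
    (hsep : ∀ θ ∈ cube (ν + 1), h θ = g (θ 0) + c (Fin.tail θ))
    (hnull : ∀ N : Set ℝ, volume N = 0 → volume {x | x ∈ circleInterval ∧ g x ∈ N} = 0)
    (N : Set ℝ) (hN : volume N = 0) :
    torusMeasure (ν + 1) {t | h (angles t) ∈ N} = 0 := by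
  wlog hNm : MeasurableSet N generalizing N
  · exact measure_mono_null (fun t ht => subset_toMeasurable volume N ht)
      (this (toMeasurable volume N) (by rw [measure_toMeasurable, hN])
        (measurableSet_toMeasurable _ _))
  set e := MeasurableEquiv.piFinSuccAbove (fun _ : Fin (ν + 1) => UnitAddCircle) 0
  have he : MeasurePreserving e (torusMeasure (ν + 1))
      ((AddCircle.haarAddCircle : Measure UnitAddCircle).prod (torusMeasure ν)) :=
    measurePreserving_piFinSuccAbove (fun _ => AddCircle.haarAddCircle) 0
  have hm : MeasurableSet {t : UnitAddTorus (Fin (ν + 1)) | h (angles t) ∈ N} :=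
    measurable_comp_angles hh hNm
  rw [← he.symm.measure_preimage hm.nullMeasurableSet,
    Measure.prod_apply_symm (e.symm.measurable hm)]
  refine (lintegral_congr fun y => ?_).trans lintegral_zero
  have hkey : (fun x => (x, y)) ⁻¹' (e.symm ⁻¹' {t | h (angles t) ∈ N}) =
      {x | g (angle x) ∈ (fun s => s + c (angles y)) ⁻¹' N} := by
    ext x
    change h (angles (e.symm (x, y))) ∈ N ↔ g (angle x) + c (angles y) ∈ N
    rw [hsep _ (angles_mem_cube _)]
    rfl
  rw [hkey]
  refine haar_preimage_angle_eq_zero hg (hNm.preimage (by fun_prop)) (hnull _ ?_)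
  rw [measure_preimage_add_right, hN]

/-! ### The spectrum of a multiplier -/

/-- Off the spectrum, `A - z` is bounded below, because the resolvent is bounded. -/
theorem exists_norm_le_mul_of_notMem_spectrum {E : Type*} [NormedAddCommGroup E]
    [NormedSpace ℂ E] {A : E →L[ℂ] E} {z : ℂ} (hz : z ∉ spectrum ℂ A) :
    ∃ C : ℝ, 0 < C ∧ ∀ u, ‖u‖ ≤ C * ‖A u - z • u‖ := by
  rw [spectrum.notMem_iff] at hz
  obtain ⟨⟨a, b, hinv, hba⟩, hab⟩ := hz
  refine ⟨‖b‖ + 1, by positivity, fun u => ?_⟩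
  have h1 : b (a u) = u := congrArg (fun T : E →L[ℂ] E => T u) hba
  have h2 : a u = z • u - A u := by
    change a = _ at hab
    rw [hab, Algebra.algebraMap_eq_smul_one]
    rfl
  rw [norm_sub_rev, ← h2]
  calc ‖u‖ = ‖b (a u)‖ := by rw [h1]
    _ ≤ ‖b‖ * ‖a u‖ := b.le_opNorm _
    _ ≤ _ := by gcongr; linarith

/-- Every neighbourhood of a value of `h` on the closed cube is hit on a set of angles of positive
measure; the closed cube is the closure of the open one, where the angles are continuous. -/
theorem torusMeasure_pos_of_mem_image {ν : ℕ} {h : (Fin ν → ℝ) → ℝ}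
    (hh : ContinuousOn h (cube ν)) {l : ℝ} (hl : l ∈ h '' cube ν) {ε : ℝ} (hε : 0 < ε) :
    0 < torusMeasure ν {t | |h (angles t) - l| < ε} := by
  obtain ⟨θ₀, hθ₀, rfl⟩ := hl
  set O : Set (Fin ν → ℝ) := Set.pi Set.univ fun _ => Set.Ioo 0 (2 * Real.pi) with hO
  have hOopen : IsOpen O := isOpen_set_pi Set.finite_univ fun _ _ => isOpen_Ioo
  have hOcube : O ⊆ cube ν := fun θ hθ j => Set.Ioo_subset_Icc_self (hθ j trivial)
  have hcl : θ₀ ∈ closure O := by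
    rw [hO, closure_pi_set]
    intro j _
    rw [closure_Ioo Real.two_pi_pos.ne]
    exact hθ₀ j
  have : (nhdsWithin θ₀ O).NeBot := mem_closure_iff_nhdsWithin_neBot.1 hcl
  have hev : ∀ᶠ θ in nhdsWithin θ₀ O, |h θ - h θ₀| < ε :=
    ((hh θ₀ hθ₀).mono hOcube).eventually (Metric.ball_mem_nhds (h θ₀) hε)
  obtain ⟨θ, hθε, hθO⟩ := (hev.and self_mem_nhdsWithin).exists
  have hθ : ∀ j, 0 < θ j ∧ θ j < 2 * Real.pi := fun j => hθO j trivial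
  set t : UnitAddTorus (Fin ν) := fun j => ((θ j / (2 * Real.pi) : ℝ) : UnitAddCircle) with ht
  have hx : ∀ j, θ j / (2 * Real.pi) ∈ Set.Ioo (0 : ℝ) 1 := fun j =>
    ⟨div_pos (hθ j).1 Real.two_pi_pos, (div_lt_one Real.two_pi_pos).2 (hθ j).2⟩
  have hang : angles t = θ := by
    ext j
    rw [angles_apply, ht, angle_coe ⟨(hx j).1.le, (hx j).2⟩]
    field_simp
  have hcont : ContinuousAt (angles (ν := ν)) t := by
    refine continuousAt_pi.2 fun j => ContinuousAt.mul continuousAt_const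
      (continuousAt_subtype_val.comp (ContinuousAt.comp (f := fun s : UnitAddTorus (Fin ν) => s j)
        (AddCircle.continuousAt_equivIco 1 0 ?_) (continuous_apply j).continuousAt))
    intro h0
    have := (AddCircle.coe_eq_coe_iff_of_mem_Ico (p := 1) (a := 0)
      (by simpa using ⟨(hx j).1.le, (hx j).2⟩) (by simp)).1 h0
    exact (hx j).1.ne' this
  have hhat : ContinuousAt h (angles t) :=
    hang ▸ hh.continuousAt (Filter.mem_of_superset (hOopen.mem_nhds hθO) hOcube)
  refine Measure.measure_pos_of_mem_nhds _ (x := t) ?_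
  refine (hhat.comp hcont).eventually (p := fun y => |y - h θ₀| < ε)
    ((isOpen_lt (by fun_prop) continuous_const).mem_nhds ?_)
  change |h (angles t) - h θ₀| < ε
  rwa [hang]

/-- Approximate eigenvectors at a value `l` of the symbol: transforms of the indicator function of the
set where the symbol is close to `l`. -/
theorem exists_norm_H0_sub_le {ν : ℕ} {h : (Fin ν → ℝ) → ℝ}
    (hh : ContinuousOn h (cube ν)) {l : ℝ} (hl : l ∈ h '' cube ν) {ε : ℝ} (hε : 0 < ε) :
    ∃ u, u ≠ 0 ∧ ‖H0 h hh u - (l : ℂ) • u‖ ≤ ε * ‖u‖ := by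
  set s : Set (UnitAddTorus (Fin ν)) := {t | |h (angles t) - l| < ε} with hs
  have hsm : MeasurableSet s :=
    measurableSet_lt ((measurable_comp_angles hh).sub_const l).abs measurable_const
  set f : L2Torus ν := indicatorConstLp 2 hsm (measure_ne_top _ _) (1 : ℂ) with hf
  have hf0 : f ≠ 0 := by
    rw [← norm_ne_zero_iff, hf, norm_indicatorConstLp (by norm_num) (by norm_num)]
    have : 0 < (torusMeasure ν).real s :=
      ENNReal.toReal_pos (torusMeasure_pos_of_mem_image hh hl hε).ne' (measure_ne_top _ _)
    simp only [norm_one, one_mul]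
    positivity
  refine ⟨fourierTransform ν f, by simpa using hf0, ?_⟩
  rw [← (fourierTransform ν).symm.norm_map, ← (fourierTransform ν).symm.norm_map
    (fourierTransform ν f), map_sub, map_smul, symm_H0_apply, LinearIsometryEquiv.symm_apply_apply]
  refine Lp.norm_le_mul_norm_of_ae_le_mul ?_
  filter_upwards [Lp.coeFn_sub (mulOperator h hh f) ((l : ℂ) • f), mulOperator_apply h hh f,
    Lp.coeFn_smul (l : ℂ) f,
    indicatorConstLp_coeFn (p := 2) (hs := hsm) (hμs := measure_ne_top (torusMeasure ν) s)
      (c := (1 : ℂ))] with t h1 h2 h3 h4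
  rw [h1, Pi.sub_apply, h2, h3, Pi.smul_apply, smul_eq_mul, ← sub_mul, norm_mul]
  by_cases hts : t ∈ s
  · refine mul_le_mul_of_nonneg_right ?_ (norm_nonneg _)
    rw [← Complex.ofReal_sub, Complex.norm_real]
    exact (le_of_lt hts : |h (angles t) - l| ≤ ε)
  · rw [hf, h4, Set.indicator_of_notMem hts]
    simp

theorem spectrum_H0 {ν : ℕ} {h : (Fin ν → ℝ) → ℝ} (hh : ContinuousOn h (cube ν)) :
    spectrum ℂ (H0 h hh) = Complex.ofReal '' (h '' cube ν) := by
  refine Set.Subset.antisymm (fun z hz => ?_) ?_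
  · have hre : z = (z.re : ℂ) := (isSelfAdjoint_H0 hh).mem_spectrum_eq_re hz
    refine ⟨z.re, ?_, hre.symm⟩
    by_contra hnot
    rw [hre] at hz
    have hk : ContinuousOn (fun _ => z.re : (Fin ν → ℝ) → ℝ) (cube ν) := continuousOn_const
    have hne : ∀ θ ∈ cube ν, ((fun _ => z.re : (Fin ν → ℝ) → ℝ) - h) θ ≠ 0 := fun θ hθ h0 =>
      hnot ⟨θ, hθ, (sub_eq_zero.1 h0).symm⟩
    have hinv := (hk.sub hh).inv₀ hne
    refine hz ?_
    rw [resolventSet, Set.mem_ofPred_eq, ← H0_const, H0_sub hk hh]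
    refine ⟨⟨H0 _ (hk.sub hh), H0 _ hinv, ?_, ?_⟩, rfl⟩
    · exact (H0_mul _ _).trans (H0_eq_one _ fun θ hθ => mul_inv_cancel₀ (hne θ hθ))
    · exact (H0_mul _ _).trans (H0_eq_one _ fun θ hθ => inv_mul_cancel₀ (hne θ hθ))
  · rintro _ ⟨l, hl, rfl⟩
    by_contra hnot
    obtain ⟨C, hC, hbound⟩ := exists_norm_le_mul_of_notMem_spectrum hnot
    obtain ⟨u, hu0, hu⟩ := exists_norm_H0_sub_le hh hl (ε := 1 / (2 * C)) (by positivity)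
    have h1 := (hbound u).trans (mul_le_mul_of_nonneg_left hu hC.le)
    have h2 : C * (1 / (2 * C) * ‖u‖) = ‖u‖ / 2 := by field_simp
    have := norm_pos_iff.2 hu0
    linarith

/-- The values of a separable function on the cube fill the interval `[E₋, E₊]`. -/
theorem image_cube_eq_Icc {ν : ℕ} {h : (Fin ν → ℝ) → ℝ} (hh : ContinuousOn h (cube ν))
    {hj : Fin ν → ℝ → ℝ} (hjc : ∀ j, ContinuousOn (hj j) circleInterval)
    (hsep : ∀ θ ∈ cube ν, h θ = ∑ j, hj j (θ j)) :
    h '' cube ν = Set.Icc (Eminus hj) (Eplus hj) := by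
  have hcpt : ∀ j, IsCompact (hj j '' circleInterval) := fun j =>
    isCompact_Icc.image_of_continuousOn (hjc j)
  have hne : ∀ j, (hj j '' circleInterval).Nonempty := fun j =>
    (Set.nonempty_Icc.2 Real.two_pi_pos.le).image _
  refine Set.Subset.antisymm ?_ ?_
  · rintro _ ⟨θ, hθ, rfl⟩
    rw [hsep θ hθ]
    exact ⟨Finset.sum_le_sum fun j _ => csInf_le (hcpt j).bddBelow ⟨_, hθ j, rfl⟩,
      Finset.sum_le_sum fun j _ => le_csSup (hcpt j).bddAbove ⟨_, hθ j, rfl⟩⟩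
  · choose a ha hae using fun j => (hcpt j).sInf_mem (hne j)
    choose b hb hbe using fun j => (hcpt j).sSup_mem (hne j)
    have hconn : IsPreconnected (cube ν) := by
      have : cube ν = Set.pi Set.univ fun _ => circleInterval := by
        ext; simp [cube]
      rw [this]
      exact isPreconnected_univ_pi fun _ => isPreconnected_Icc
    have hiv := hconn.intermediate_value (a := a) (b := b) ha hb hh
    rwa [hsep a ha, hsep b hb, Finset.sum_congr rfl fun j _ => hae j,
      Finset.sum_congr rfl fun j _ => hbe j] at hiv

/-! ### The bulk operator -/

section Bulk

variable {ν : ℕ}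

/-- The layer `w(m, ·)` of an element `w` of `ℓ²(ℤ^{ν+1})`. -/
def layer (m : ℤ) : ell2 (Fin (ν + 1) → ℤ) →L[ℂ] ell2 (Fin ν → ℤ) :=
  comp (fun b => (Fin.cons m b : Fin (ν + 1) → ℤ))
    (Fin.cons_right_injective (α := fun _ => ℤ) m)

theorem layer_apply (m : ℤ) (w : ell2 (Fin (ν + 1) → ℤ)) (b : Fin ν → ℤ) :
    layer m w b = w (Fin.cons m b) := rfl

theorem neg_cons (m : ℤ) (b : Fin ν → ℤ) :
    -(Fin.cons m b : Fin (ν + 1) → ℤ) = Fin.cons (-m) (-b) := by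
  ext j
  refine Fin.cases ?_ (fun j => ?_) j <;> simp

theorem mFourier_cons (m : ℤ) (b : Fin ν → ℤ) (t : UnitAddTorus (Fin (ν + 1))) :
    UnitAddTorus.mFourier (Fin.cons m b) t =
      fourier m (t 0) * UnitAddTorus.mFourier b (Fin.tail t) := by
  change (∏ j, fourier _ (t j) : ℂ) = fourier m (t 0) * ∏ j, fourier (b j) (t j.succ)
  rw [Fin.prod_univ_succ]
  simp

theorem fourierTransform_symm_single (q : Fin ν → ℤ) :
    (fourierTransform ν).symm (lp.single 2 q (1 : ℂ)) = UnitAddTorus.mFourierLp 2 q := by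
  classical
  rw [← UnitAddTorus.coe_mFourierBasis]
  convert! UnitAddTorus.mFourierBasis.repr_symm_single q

theorem integral_fourier_mul (m k : ℤ) :
    ∫ x : UnitAddCircle, fourier (-m) x * fourier k x ∂AddCircle.haarAddCircle =
      if k = m then (1 : ℂ) else 0 := by
  simp_rw [← fourier_add]
  split_ifs with h
  · simp [h]
  · have hij : -m + k ≠ 0 := by omega
    exact integral_eq_zero_of_add_right_eq_neg (μ := AddCircle.haarAddCircle)
      (fourier_add_half_inv_index hij one_pos)

theorem ofReal_two_mul_cos_angle (x : UnitAddCircle) :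
    ((2 * Real.cos (angle x) : ℝ) : ℂ) = fourier 1 x + fourier (-1) x := by
  have hx : x = ((AddCircle.equivIco 1 0 x : ℝ) : UnitAddCircle) :=
    ((AddCircle.equivIco 1 0).symm_apply_apply x).symm
  conv_rhs => rw [hx]
  rw [fourier_coe_apply, fourier_coe_apply]
  push_cast
  rw [Complex.two_cos, angle]
  congr 2 <;> (push_cast; ring)

theorem continuousOn_tail {h : (Fin ν → ℝ) → ℝ} (hh : ContinuousOn h (cube ν)) :
    ContinuousOn (fun θ : Fin (ν + 1) → ℝ => h (Fin.tail θ)) (cube (ν + 1)) :=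
  hh.comp (Continuous.continuousOn (continuous_pi fun j => continuous_apply j.succ))
    fun _ hθ j => hθ j.succ

theorem continuousOn_two_mul_cos :
    ContinuousOn (fun θ : Fin (ν + 1) → ℝ => 2 * Real.cos (θ 0)) (cube (ν + 1)) := by
  fun_prop

/-- The multiplier with symbol `2 cos θ₀` is the Laplacian in the first variable. -/
theorem H0_two_mul_cos_apply (w : ell2 (Fin (ν + 1) → ℤ)) (m : ℤ) (b : Fin ν → ℤ) :
    H0 _ continuousOn_two_mul_cos w (Fin.cons m b) =
      w (Fin.cons (m + 1) b) + w (Fin.cons (m - 1) b) := by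
  set f : L2Torus (ν + 1) := (fourierTransform (ν + 1)).symm w with hf
  have hw : ∀ n, w n = ∫ t, UnitAddTorus.mFourier (-n) t * f t ∂(torusMeasure (ν + 1)) := by
    intro n
    rw [← fourierTransform_apply, hf, LinearIsometryEquiv.apply_symm_apply]
  have hfi : Integrable f (torusMeasure (ν + 1)) :=
    (Lp.memLp f).integrable (by norm_num)
  have hint : ∀ n : Fin (ν + 1) → ℤ,
      Integrable (fun t => UnitAddTorus.mFourier n t * f t) (torusMeasure (ν + 1)) := fun n =>
    hfi.bdd_mul (c := 1) (UnitAddTorus.mFourier n).continuous.aestronglyMeasurable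
      (Filter.Eventually.of_forall fun t => by
        exact ((UnitAddTorus.mFourier n).norm_coe_le_norm t).trans_eq UnitAddTorus.mFourier_norm)
  rw [H0_apply, hw, hw, ← integral_add (hint _) (hint _)]
  refine integral_congr_ae (Filter.Eventually.of_forall fun t => ?_)
  simp only [angles_apply, ofReal_two_mul_cos_angle, neg_cons, mFourier_cons]
  rw [show -(m + 1) = -m + -1 by ring, show -(m - 1) = -m + 1 by ring, fourier_add, fourier_add,
    ← hf]
  ring

/-- The multiplier with a symbol that does not depend on `θ₀` acts on each layer. -/
theorem H0_tail_apply {h : (Fin ν → ℝ) → ℝ} (hh : ContinuousOn h (cube ν))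
    (w : ell2 (Fin (ν + 1) → ℤ)) (m : ℤ) (b : Fin ν → ℤ) :
    H0 _ (continuousOn_tail hh) w (Fin.cons m b) = H0 h hh (layer m w) b := by
  classical
  suffices hclm : (lp.evalCLM ℂ (fun _ : Fin (ν + 1) → ℤ => ℂ) 2 (Fin.cons m b)).comp
      (H0 _ (continuousOn_tail hh)) =
      (lp.evalCLM ℂ (fun _ : Fin ν → ℤ => ℂ) 2 b).comp ((H0 h hh).comp (layer m)) from
    congrArg (fun T : ell2 (Fin (ν + 1) → ℤ) →L[ℂ] ℂ => T w) hclm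
  refine lp.ext_continuousLinearMap (by norm_num) fun q => ContinuousLinearMap.ext_ring ?_
  obtain ⟨k, b', rfl⟩ : ∃ (k : ℤ) (b' : Fin ν → ℤ), q = Fin.cons k b' :=
    ⟨q 0, Fin.tail q, (Fin.cons_self_tail q).symm⟩
  change H0 _ (continuousOn_tail hh) (lp.single 2 (Fin.cons k b') (1 : ℂ)) (Fin.cons m b) =
    H0 h hh (layer m (lp.single 2 (Fin.cons k b') (1 : ℂ))) b
  have hlayer : layer m (lp.single 2 (Fin.cons k b') (1 : ℂ)) =
      (if k = m then (1 : ℂ) else 0) • (lp.single 2 b' (1 : ℂ) : ell2 (Fin ν → ℤ)) := by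
    ext c
    rw [layer_apply, lp.coeFn_smul, Pi.smul_apply, smul_eq_mul]
    simp only [lp.single_apply, Pi.single_apply, Fin.cons_inj, eq_comm (a := m)]
    split_ifs <;> simp_all
  rw [hlayer, map_smul, lp.coeFn_smul, Pi.smul_apply, H0_apply, H0_apply,
    fourierTransform_symm_single, fourierTransform_symm_single, smul_eq_mul,
    ← integral_fourier_mul, ← integral_prod_mul]
  set e := MeasurableEquiv.piFinSuccAbove (fun _ : Fin (ν + 1) => UnitAddCircle) 0
  have he : MeasurePreserving e (torusMeasure (ν + 1))
      ((AddCircle.haarAddCircle : Measure UnitAddCircle).prod (torusMeasure ν)) :=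
    measurePreserving_piFinSuccAbove (fun _ => AddCircle.haarAddCircle) 0
  have hb : (fun y => UnitAddTorus.mFourierLp (d := Fin ν) 2 b' y) =ᵐ[torusMeasure ν]
      fun y => UnitAddTorus.mFourier b' y := UnitAddTorus.coeFn_mFourierLp 2 b'
  rw [← he.integral_comp' (g := fun z : UnitAddCircle × UnitAddTorus (Fin ν) =>
    fourier (-m) z.1 * fourier k z.1 * (UnitAddTorus.mFourier (-b) z.2 *
      ((h (angles z.2) : ℂ) * UnitAddTorus.mFourierLp (d := Fin ν) 2 b' z.2)))]
  refine integral_congr_ae ?_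
  filter_upwards [UnitAddTorus.coeFn_mFourierLp 2 (Fin.cons k b' : Fin (ν + 1) → ℤ),
    he.quasiMeasurePreserving.tendsto_ae (Measure.quasiMeasurePreserving_snd.tendsto_ae hb)]
    with t h1 h2
  have h2' : UnitAddTorus.mFourierLp (d := Fin ν) 2 b' (e t).2 =
    UnitAddTorus.mFourier b' (Fin.tail t) := h2
  rw [h1, h2', neg_cons, mFourier_cons, mFourier_cons]
  change fourier (-m) (t 0) * _ * ((h (angles (Fin.tail t)) : ℂ) * _) =
    fourier (-m) (t 0) * fourier k (t 0) * 
      (UnitAddTorus.mFourier (-b) (Fin.tail t) * ((h (angles (Fin.tail t)) : ℂ) * _))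
  ring

/-- The symbol `2 cos θ₀ + h(θ₁, …, θ_ν)` of the translation invariant extension of `H₀₊` to the
whole space. -/
def bulkSymbol (h : (Fin ν → ℝ) → ℝ) (θ : Fin (ν + 1) → ℝ) : ℝ :=
  2 * Real.cos (θ 0) + h (Fin.tail θ)

theorem continuousOn_bulkSymbol {h : (Fin ν → ℝ) → ℝ} (hh : ContinuousOn h (cube ν)) :
    ContinuousOn (bulkSymbol h) (cube (ν + 1)) :=
  continuousOn_two_mul_cos.add (continuousOn_tail hh)

theorem H0_bulkSymbol_apply {h : (Fin ν → ℝ) → ℝ} (hh : ContinuousOn h (cube ν))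
    (w : ell2 (Fin (ν + 1) → ℤ)) (m : ℤ) (b : Fin ν → ℤ) :
    H0 _ (continuousOn_bulkSymbol hh) w (Fin.cons m b) =
      w (Fin.cons (m + 1) b) + w (Fin.cons (m - 1) b) + H0 h hh (layer m w) b := by
  rw [← H0_two_mul_cos_apply, ← H0_tail_apply hh, ← sub_eq_iff_eq_add]
  rw [← H0_congr (h := bulkSymbol h - fun θ => h (Fin.tail θ))
    ((continuousOn_bulkSymbol hh).sub (continuousOn_tail hh)) continuousOn_two_mul_cos
    (fun θ _ => add_sub_cancel_right _ _), ← H0_sub]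
  rfl

end Bulk

/-! ### Odd reflection -/

section Reflection

theorem inner_single_one {α : Type*} [DecidableEq α] (v : ell2 α) (a : α) :
    inner ℂ (lp.single 2 a (1 : ℂ) : ell2 α) v = v a := by
  simp [lp.inner_single_left]

theorem adjoint_comp_apply_self {ι κ : Type*} (e : ι → κ) (he : Function.Injective e)
    (u : ell2 ι) (i : ι) : (comp e he).adjoint u (e i) = u i := by
  classical
  have h1 : comp e he (lp.single 2 (e i) (1 : ℂ)) = lp.single 2 i (1 : ℂ) := by
    ext j
    simp only [comp_apply, lp.single_apply, Pi.single_apply, he.eq_iff]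
  rw [← inner_single_one, ContinuousLinearMap.adjoint_inner_right, h1, inner_single_one]

theorem adjoint_comp_apply_of_notMem {ι κ : Type*} (e : ι → κ) (he : Function.Injective e)
    (u : ell2 ι) {k : κ} (hk : k ∉ Set.range e) : (comp e he).adjoint u k = 0 := by
  classical
  have h1 : comp e he (lp.single 2 k (1 : ℂ)) = 0 := by
    ext j
    have : e j ≠ k := fun h => hk ⟨j, h⟩
    simp [lp.single_apply, this]
  rw [← inner_single_one, ContinuousLinearMap.adjoint_inner_right, h1, inner_zero_left]

variable {ν : ℕ}

/-- The site `(n - N, b)` of `ℤ^{ν+1}`, for `(n, b)` in the half-space. -/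
def shiftedSite (N : ℤ) (p : ℕ × (Fin ν → ℤ)) : Fin (ν + 1) → ℤ := Fin.cons (p.1 - N) p.2

theorem shiftedSite_injective (N : ℤ) : Function.Injective (shiftedSite (ν := ν) N) := by
  intro p q h
  obtain ⟨h1, h2⟩ := Fin.cons_inj.1 h
  exact Prod.ext (by omega) h2

/-- The mirror image `(-1 - n, b)` of the site `(n + 1, b)` in the layer `0`. -/
def mirrorSite (p : ℕ × (Fin ν → ℤ)) : Fin (ν + 1) → ℤ := Fin.cons (-1 - p.1) p.2

theorem mirrorSite_injective : Function.Injective (mirrorSite (ν := ν)) := by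
  intro p q h
  obtain ⟨h1, h2⟩ := Fin.cons_inj.1 h
  exact Prod.ext (by omega) h2

/-- The odd extension of `u ∈ ℓ²(ℕ × ℤ^ν)`: it is `u(n, b)` at `(n + 1, b)`, `-u(n, b)` at
`(-n - 1, b)`, and vanishes at `(0, b)`. -/
def oddExtension : ell2 (ℕ × (Fin ν → ℤ)) →L[ℂ] ell2 (Fin (ν + 1) → ℤ) :=
  (comp (shiftedSite (-1)) (shiftedSite_injective (-1))).adjoint -
    (comp mirrorSite mirrorSite_injective).adjoint

theorem oddExtension_pos (u : ell2 (ℕ × (Fin ν → ℤ))) (n : ℕ) (b : Fin ν → ℤ) {m : ℤ}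
    (hm : m = n + 1) : oddExtension u (Fin.cons m b) = u (n, b) := by
  subst hm
  change (comp _ (shiftedSite_injective (-1))).adjoint u (Fin.cons ((n : ℤ) + 1) b) -
    (comp _ mirrorSite_injective).adjoint u (Fin.cons ((n : ℤ) + 1) b) = _
  have h1 := adjoint_comp_apply_self _ (shiftedSite_injective (-1)) u (n, b)
  rw [shiftedSite, sub_neg_eq_add] at h1
  rw [h1, adjoint_comp_apply_of_notMem, sub_zero]
  rintro ⟨p, hp⟩
  have := (Fin.cons_inj.1 hp).1
  omega

theorem oddExtension_zero (u : ell2 (ℕ × (Fin ν → ℤ))) (b : Fin ν → ℤ) :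
    oddExtension u (Fin.cons 0 b) = 0 := by
  change (comp _ (shiftedSite_injective (-1))).adjoint u (Fin.cons 0 b) -
    (comp _ mirrorSite_injective).adjoint u (Fin.cons 0 b) = _
  rw [adjoint_comp_apply_of_notMem, adjoint_comp_apply_of_notMem, sub_zero]
  · rintro ⟨p, hp⟩
    have := (Fin.cons_inj.1 hp).1
    omega
  · rintro ⟨p, hp⟩
    have := (Fin.cons_inj.1 hp).1
    omega

theorem oddExtension_neg (u : ell2 (ℕ × (Fin ν → ℤ))) (n : ℕ) (b : Fin ν → ℤ) {m : ℤ}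
    (hm : m = -1 - n) : oddExtension u (Fin.cons m b) = -u (n, b) := by
  subst hm
  change (comp _ (shiftedSite_injective (-1))).adjoint u (Fin.cons (-1 - (n : ℤ)) b) -
    (comp _ mirrorSite_injective).adjoint u (Fin.cons (-1 - (n : ℤ)) b) = _
  have h1 := adjoint_comp_apply_self _ mirrorSite_injective u (n, b)
  rw [mirrorSite] at h1
  rw [h1, adjoint_comp_apply_of_notMem, zero_sub]
  rintro ⟨p, hp⟩
  have := (Fin.cons_inj.1 hp).1
  omega

/-- The odd extension is `√2` times an isometry. -/
theorem inner_oddExtension (u v : ell2 (ℕ × (Fin ν → ℤ))) :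
    inner ℂ (oddExtension u) (oddExtension v) = 2 * inner ℂ u v := by
  have h1 : comp _ (shiftedSite_injective (-1)) (oddExtension v) = v := by
    ext p
    exact oddExtension_pos v p.1 p.2 (sub_neg_eq_add _ _)
  have h2 : comp _ mirrorSite_injective (oddExtension v) = -v := by
    ext p
    exact oddExtension_neg v p.1 p.2 rfl
  have h3 : oddExtension u = (comp _ (shiftedSite_injective (-1))).adjoint u -
    (comp _ mirrorSite_injective).adjoint u := rfl
  rw [h3, inner_sub_left, ContinuousLinearMap.adjoint_inner_left,
    ContinuousLinearMap.adjoint_inner_left, h1, h2, inner_neg_right]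
  ring

variable {h : (Fin ν → ℝ) → ℝ} (hh : ContinuousOn h (cube ν))

theorem H0plus_apply_zero (u : ell2 (ℕ × (Fin ν → ℤ))) (b : Fin ν → ℤ) :
    H0plus h hh u (0, b) = u (1, b) + H0 h hh (slice 0 u) b := by
  rw [← halfLaplacian_zero]
  rfl

theorem H0plus_apply_succ (u : ell2 (ℕ × (Fin ν → ℤ))) (n : ℕ) (b : Fin ν → ℤ) :
    H0plus h hh u (n + 1, b) = u (n + 2, b) + u (n, b) + H0 h hh (slice (n + 1) u) b := by
  rw [← halfLaplacian_succ]
  rfl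

/-- Odd extension intertwines `H₀₊` with the bulk operator, since the Dirichlet condition at the
boundary of the half-space is the vanishing of the odd extension on the layer `0`. -/
theorem oddExtension_H0plus (u : ell2 (ℕ × (Fin ν → ℤ))) :
    oddExtension (H0plus h hh u) = H0 _ (continuousOn_bulkSymbol hh) (oddExtension u) := by
  ext q
  obtain ⟨m, b, rfl⟩ : ∃ (m : ℤ) (b : Fin ν → ℤ), q = Fin.cons m b :=
    ⟨q 0, Fin.tail q, (Fin.cons_self_tail q).symm⟩
  rw [H0_bulkSymbol_apply]
  obtain ⟨n, rfl⟩ | rfl | ⟨n, rfl⟩ : (∃ n : ℕ, m = n + 1) ∨ m = 0 ∨ ∃ n : ℕ, m = -1 - n := by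
    rcases lt_trichotomy m 0 with h0 | h0 | h0
    · exact Or.inr (Or.inr ⟨(-1 - m).toNat, by omega⟩)
    · exact Or.inr (Or.inl h0)
    · exact Or.inl ⟨(m - 1).toNat, by omega⟩
  · have hl : layer ((n : ℤ) + 1) (oddExtension u) = slice n u := by
      ext c
      exact oddExtension_pos u n c rfl
    rw [oddExtension_pos _ n b rfl, hl, oddExtension_pos _ (n + 1) b (by push_cast; ring)]
    rcases n with _ | n
    · rw [H0plus_apply_zero]
      simp [oddExtension_zero]
    · rw [H0plus_apply_succ, oddExtension_pos _ n b (by push_cast; ring)]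
  · have hl : layer 0 (oddExtension u) = 0 := by
      ext c
      exact oddExtension_zero u c
    rw [oddExtension_zero, hl, oddExtension_pos u 0 b (by simp), oddExtension_neg u 0 b (by simp)]
    simp
  · have hl : layer (-1 - (n : ℤ)) (oddExtension u) = -slice n u := by
      ext c
      exact oddExtension_neg u n c rfl
    rw [oddExtension_neg _ n b rfl, hl, map_neg, lp.coeFn_neg, Pi.neg_apply,
      oddExtension_neg u (n + 1) b (m := -1 - (n : ℤ) - 1) (by push_cast; ring)]
    rcases n with _ | n
    · rw [H0plus_apply_zero]
      simp [oddExtension_zero]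
      ring
    · rw [H0plus_apply_succ, oddExtension_neg u n b (by push_cast; ring)]
      ring

theorem oddExtension_H0plus_pow (n : ℕ) (u : ell2 (ℕ × (Fin ν → ℤ))) :
    oddExtension ((H0plus h hh ^ n) u) =
      (H0 _ (continuousOn_bulkSymbol hh) ^ n) (oddExtension u) := by
  induction n with
  | zero => rfl
  | succ n ih =>
    rw [pow_succ', pow_succ']
    change oddExtension (H0plus h hh ((H0plus h hh ^ n) u)) =
      H0 _ (continuousOn_bulkSymbol hh) ((H0 _ (continuousOn_bulkSymbol hh) ^ n) (oddExtension u))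
    rw [oddExtension_H0plus, ih]

theorem isSelfAdjoint_H0plus : IsSelfAdjoint (H0plus h hh) := by
  rw [ContinuousLinearMap.isSelfAdjoint_iff_isSymmetric]
  intro u v
  change inner ℂ (H0plus h hh u) v = inner ℂ u (H0plus h hh v)
  have h1 := inner_oddExtension (H0plus h hh u) v
  have h2 := inner_oddExtension u (H0plus h hh v)
  rw [oddExtension_H0plus] at h1 h2
  have h3 := (ContinuousLinearMap.isSelfAdjoint_iff_isSymmetric.1
    (isSelfAdjoint_H0 (continuousOn_bulkSymbol hh))) (oddExtension u) (oddExtension v)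
  refine mul_left_cancel₀ (two_ne_zero (α := ℂ)) (h1.symm.trans (Eq.trans h3 h2))

theorem criticalSet_two_mul_cos_finite : (criticalSet fun x => 2 * Real.cos x).Finite := by
  refine Set.Finite.subset (Set.toFinite {0, Real.pi, 2 * Real.pi}) ?_
  rintro x ⟨hx, hd⟩
  have hder : HasDerivAt (fun x => 2 * Real.cos x) (2 * -Real.sin x) x :=
    (Real.hasDerivAt_cos x).const_mul 2
  rw [circleInterval, hder.hasDerivWithinAt.derivWithin (uniqueDiffOn_Icc Real.two_pi_pos x hx)] at hd
  have hsin : Real.sin x = 0 := by linarith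
  by_contra hnot
  simp only [Set.mem_insert_iff, Set.mem_singleton_iff, not_or] at hnot
  obtain ⟨h0, h1, h2⟩ := hnot
  have hx0 : 0 < x := lt_of_le_of_ne hx.1 (Ne.symm h0)
  have hx2 : x < 2 * Real.pi := lt_of_le_of_ne hx.2 h2
  rcases lt_or_gt_of_ne h1 with h3 | h3
  · exact (Real.sin_pos_of_pos_of_lt_pi hx0 h3).ne' hsin
  · have := Real.sin_pos_of_pos_of_lt_pi (x := x - Real.pi) (by linarith) (by linarith)
    rw [Real.sin_sub_pi, hsin, neg_zero] at this
    exact this.false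

/-- The term `2 cos θ₀` alone makes the bulk symbol pull null sets back to null sets, so the bulk
spectral measures are absolutely continuous, and odd extension transports them to `H₀₊`. -/
theorem hasPurelyACSpectrum_H0plus : HasPurelyACSpectrum (H0plus h hh) := by
  refine ⟨isSelfAdjoint_H0plus hh, fun u => ?_⟩
  obtain ⟨μ, R, hfin, hR, hac, hmom⟩ :=
    exists_isSpectralMeasure_H0 (continuousOn_bulkSymbol hh)
      (torusMeasure_preimage_eq_zero (continuousOn_bulkSymbol hh)
        (g := fun x => 2 * Real.cos x) (by fun_prop) h (fun _ _ => rfl)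
        fun N hN => volume_preimage_eq_zero (by fun_prop) criticalSet_two_mul_cos_finite hN)
      (oddExtension u)
  -- Odd extension doubles squared norms, hence the factor `1 / 2`.
  refine ⟨(2⁻¹ : NNReal) • μ, isSpectralMeasure_of_moments (isSelfAdjoint_H0plus hh)
    (μ := (2⁻¹ : NNReal) • μ) (R := R) (Measure.ae_smul_measure hR _) fun n => ?_,
    hac.smul_left _⟩
  have h1 := inner_oddExtension u ((H0plus h hh ^ n) u)
  rw [oddExtension_H0plus_pow, hmom] at h1
  rw [integral_smul_nnreal_measure, NNReal.smul_def, smul_eq_mul, Complex.ofReal_mul, h1]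
  simp

end Reflection

/-! ### The spectrum in the half-space -/

section HalfSpaceSpectrum

variable {ν : ℕ} {h : (Fin ν → ℝ) → ℝ} (hh : ContinuousOn h (cube ν))

/-- Restricting to the half-space `n ≥ -N` commutes with the Hamiltonians up to a boundary term,
supported on the layer `0`, which only sees the layer `-N - 1`. -/
theorem H0plus_comp_shiftedSite (N : ℤ) (w : ell2 (Fin (ν + 1) → ℤ)) :
    H0plus h hh (comp _ (shiftedSite_injective N) w) =
      comp _ (shiftedSite_injective N) (H0 _ (continuousOn_bulkSymbol hh) w) -
        (slice (0 : ℕ)).adjoint (layer (-N - 1) w) := by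
  ext ⟨n, b⟩
  rw [lp.coeFn_sub, Pi.sub_apply]
  have hb : comp _ (shiftedSite_injective N) (H0 _ (continuousOn_bulkSymbol hh) w) (n, b) =
    w (Fin.cons (n - N + 1) b) + w (Fin.cons (n - N - 1) b) + H0 h hh (layer (n - N) w) b :=
    H0_bulkSymbol_apply hh w (n - N) b
  have hs : slice n (comp _ (shiftedSite_injective N) w) = layer (n - N) w := rfl
  have hw : ∀ k : ℕ, comp _ (shiftedSite_injective N) w (k, b) = w (Fin.cons (k - N) b) :=
    fun k => rfl
  rw [hb, ← hs]
  rcases n with _ | n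
  · have h0 : (slice (0 : ℕ)).adjoint (layer (-N - 1) w) (0, b) = w (Fin.cons (-N - 1) b) :=
      adjoint_comp_apply_self _ (Prod.mk_right_injective 0) _ b
    rw [H0plus_apply_zero, h0, hw]
    simp only [Nat.cast_zero, Nat.cast_one, zero_sub]
    rw [show -N + 1 = 1 - N by ring]
    ring
  · have h0 : (slice (0 : ℕ)).adjoint (layer (-N - 1) w) (n + 1, b) = 0 :=
      adjoint_comp_apply_of_notMem _ (Prod.mk_right_injective 0) _ (by simp)
    rw [H0plus_apply_succ, h0, hw, hw, sub_zero,
      show ((n + 1 : ℕ) : ℤ) - N + 1 = ((n + 2 : ℕ) : ℤ) - N by push_cast; ring,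
      show ((n + 1 : ℕ) : ℤ) - N - 1 = (n : ℤ) - N by push_cast; ring]

theorem norm_comp_le {ι κ : Type*} (e : ι → κ) (he : Function.Injective e) : ‖comp e he‖ ≤ 1 :=
  LinearMap.mkContinuous_norm_le _ zero_le_one _

theorem norm_sq_eq_tsum_layer (w : ell2 (Fin (ν + 1) → ℤ)) :
    (Summable fun m : ℤ => ‖layer m w‖ ^ 2) ∧ ‖w‖ ^ 2 = ∑' m : ℤ, ‖layer m w‖ ^ 2 := by
  have hinj : Function.Injective (Fin.consEquiv fun _ : Fin (ν + 1) => ℤ) := Equiv.injective _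
  have h1 := norm_sq_eq_tsum_slice (comp (Fin.consEquiv fun _ : Fin (ν + 1) => ℤ) hinj w)
  refine ⟨h1.1, Eq.trans ?_ h1.2⟩
  rw [norm_sq_eq_tsum, norm_sq_eq_tsum]
  exact ((Fin.consEquiv fun _ : Fin (ν + 1) => ℤ).tsum_eq fun q => ‖w q‖ ^ 2).symm

/-- A lower bound for `H₀₊ - z` on the half-space is a lower bound for the bulk operator. -/
theorem norm_le_bulk_of_norm_le_halfSpace {z : ℂ} {C : ℝ} (hC : 0 < C)
    (hbound : ∀ u, ‖u‖ ≤ C * ‖H0plus h hh u - z • u‖) (w : ell2 (Fin (ν + 1) → ℤ)) :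
    ‖w‖ ≤ C * ‖H0 _ (continuousOn_bulkSymbol hh) w - z • w‖ := by
  set D : ℝ := ‖H0 _ (continuousOn_bulkSymbol hh) w - z • w‖ with hD
  obtain ⟨hsum, hnorm⟩ := norm_sq_eq_tsum_layer w
  have hN : ∀ N : ℤ, ‖comp _ (shiftedSite_injective N) w‖ ≤ C * (D + ‖layer (-N - 1) w‖) := by
    intro N
    refine (hbound _).trans (mul_le_mul_of_nonneg_left ?_ hC.le)
    have : H0plus h hh (comp _ (shiftedSite_injective N) w) -
        z • comp _ (shiftedSite_injective N) w =
        comp _ (shiftedSite_injective N) (H0 _ (continuousOn_bulkSymbol hh) w - z • w) -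
        (slice (0 : ℕ)).adjoint (layer (-N - 1) w) := by
      rw [H0plus_comp_shiftedSite, map_sub, map_smul]
      abel
    rw [this]
    refine (norm_sub_le _ _).trans (add_le_add ?_ ?_)
    · exact ((comp _ _).le_of_opNorm_le (norm_comp_le _ _) _).trans_eq (one_mul _)
    · refine (ContinuousLinearMap.le_of_opNorm_le _ (c := 1) ?_ _).trans_eq (one_mul _)
      rw [LinearIsometryEquiv.norm_map]
      exact norm_comp_le _ _
  -- The layers of a square summable `w` tend to `0`, so the boundary term disappears as `N → ∞`.
  have hlim : Filter.Tendsto (fun N : ℕ => ‖layer (-(N : ℤ) - 1) w‖) Filter.atTop (nhds 0) := by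
    have hinj : Function.Injective fun N : ℕ => -(N : ℤ) - 1 := fun a b hab => by
      have : -(a : ℤ) - 1 = -(b : ℤ) - 1 := hab
      omega
    have h1 := (hsum.comp_injective hinj).tendsto_atTop_zero.sqrt
    simpa [Function.comp_def, Real.sqrt_sq] using h1
  have hpart : ∀ s : Finset ℤ, ∑ m ∈ s, ‖layer m w‖ ^ 2 ≤ (C * D) ^ 2 := by
    intro s
    have hlim2 : Filter.Tendsto (fun N : ℕ => (C * (D + ‖layer (-(N : ℤ) - 1) w‖)) ^ 2)
        Filter.atTop (nhds ((C * (D + 0)) ^ 2)) := ((hlim.const_add D).const_mul C).pow 2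
    rw [add_zero] at hlim2
    refine ge_of_tendsto hlim2 ?_
    -- As soon as `-N` is below `s`, the half-space `n ≥ -N` contains all the layers in `s`.
    obtain ⟨M, hM⟩ := s.bddBelow
    filter_upwards [Filter.eventually_ge_atTop (-M).toNat] with N hNM
    have hpos : ∀ m ∈ s, 0 ≤ m + N := fun m hm => by
      have := hM hm
      omega
    obtain ⟨hsl, hsn⟩ := norm_sq_eq_tsum_slice (comp _ (shiftedSite_injective (N : ℤ)) w)
    refine le_trans ?_ (pow_le_pow_left₀ (norm_nonneg _) (hN N) 2)
    rw [hsn]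
    refine le_trans (le_of_eq ?_) (hsl.sum_le_tsum (s.image fun m => (m + (N : ℤ)).toNat)
      fun _ _ => sq_nonneg _)
    rw [Finset.sum_image fun a ha b hb hab => by
      have h1 := hpos a ha
      have h2 := hpos b hb
      have : (a + (N : ℤ)).toNat = (b + (N : ℤ)).toNat := hab
      omega]
    refine Finset.sum_congr rfl fun m hm => ?_
    change _ = ‖layer (((m + (N : ℤ)).toNat : ℤ) - N) w‖ ^ 2
    rw [Int.toNat_of_nonneg (hpos m hm), add_sub_cancel_right]
  refine le_of_sq_le_sq ?_ (by positivity)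
  rw [hnorm]
  exact hsum.tsum_le_of_sum_le hpart

theorem image_bulkSymbol_subset_spectrum :
    Complex.ofReal '' (bulkSymbol h '' cube (ν + 1)) ⊆ spectrum ℂ (H0plus h hh) := by
  rintro _ ⟨l, hl, rfl⟩
  by_contra hnot
  obtain ⟨C, hC, hbound⟩ := exists_norm_le_mul_of_notMem_spectrum hnot
  obtain ⟨w, hw0, hw⟩ :=
    exists_norm_H0_sub_le (continuousOn_bulkSymbol hh) hl (ε := 1 / (2 * C)) (by positivity)
  have h1 := (norm_le_bulk_of_norm_le_halfSpace hh hC hbound w).trans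
    (mul_le_mul_of_nonneg_left hw hC.le)
  have h2 : C * (1 / (2 * C) * ‖w‖) = ‖w‖ / 2 := by field_simp
  have := norm_pos_iff.2 hw0
  linarith

/-- `2 cos` takes every value in `[-2, 2]`, so the values of the bulk symbol include every sum of
such a value and a value of `h`. -/
theorem Icc_subset_image_bulkSymbol {a b : ℝ} (hab : h '' cube ν = Set.Icc a b) :
    Set.Icc (-2 + a) (2 + b) ⊆ bulkSymbol h '' cube (ν + 1) := by
  rintro l ⟨hl1, hl2⟩
  have hle : a ≤ b := by
    have h0 : h 0 ∈ Set.Icc a b := hab ▸ ⟨0, fun _ => ⟨le_rfl, Real.two_pi_pos.le⟩, rfl⟩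
    exact h0.1.trans h0.2
  obtain ⟨x, hx1, hx2, y, hy, hxy⟩ : ∃ x, -1 ≤ x ∧ x ≤ 1 ∧ ∃ y ∈ Set.Icc a b, 2 * x + y = l := by
    rcases le_total (l - 2) a with h1 | h1
    · exact ⟨(l - a) / 2, by linarith, by linarith, a, ⟨le_rfl, hle⟩, by ring⟩
    · exact ⟨1, by norm_num, le_rfl, l - 2, ⟨h1, by linarith⟩, by ring⟩
  rw [← hab] at hy
  obtain ⟨θ, hθ, rfl⟩ := hy
  refine ⟨Fin.cons (Real.arccos x) θ, fun j => ?_, ?_⟩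
  · refine Fin.cases ?_ (fun j => ?_) j
    · exact ⟨Real.arccos_nonneg x, by
        have h1 := Real.arccos_le_pi x
        have h2 := Real.pi_pos
        simp only [Fin.cons_zero]
        linarith⟩
    · exact hθ j
  · rw [bulkSymbol, Fin.cons_zero, Fin.tail_cons, Real.cos_arccos hx1 hx2, hxy]

end HalfSpaceSpectrum

/-! ### Separable symbols -/

/-- The summands of a separable symbol, about which nothing is assumed, are smooth on `[0, 2π]`: up
to a constant, each is the symbol with the other angles frozen at `0`. -/
theorem contDiffOn_of_separable {ν : ℕ} {h : (Fin ν → ℝ) → ℝ} {hj : Fin ν → ℝ → ℝ}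
    (hh : ContDiffOn ℝ 1 h (cube ν)) (hsep : ∀ θ ∈ cube ν, h θ = ∑ j, hj j (θ j)) (j : Fin ν) :
    ContDiffOn ℝ 1 (hj j) circleInterval := by
  have hmem : ∀ x ∈ circleInterval, Function.update (0 : Fin ν → ℝ) j x ∈ cube ν := by
    intro x hx i
    rcases eq_or_ne i j with rfl | hij
    · simpa using hx
    · rw [Function.update_of_ne hij]
      exact ⟨le_rfl, Real.two_pi_pos.le⟩
  have h1 : ContDiffOn ℝ 1 (fun x => h (Function.update (0 : Fin ν → ℝ) j x) -
      ∑ i ∈ Finset.univ.erase j, hj i 0) circleInterval :=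
    (hh.comp (contDiff_update 1 (0 : Fin ν → ℝ) j).contDiffOn hmem).sub contDiffOn_const
  refine h1.congr fun x hx => ?_
  rw [hsep _ (hmem x hx), ← Finset.add_sum_erase _ _ (Finset.mem_univ j), eq_sub_iff_add_eq,
    Function.update_self]
  refine congrArg _ (Finset.sum_congr rfl fun i hi => ?_)
  rw [Function.update_of_ne (Finset.ne_of_mem_erase hi), Pi.zero_apply]

end HalfSpaceModel

end

theorem theorem1p0 (ν : ℕ) (hν : 1 ≤ ν) (h : (Fin ν → ℝ) → ℝ) (hj : Fin ν → ℝ → ℝ)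
    (hsmooth : ContDiffOn ℝ ((3 * ν + 3 : ℕ) : WithTop ℕ∞) h (HalfSpaceModel.cube ν))
    (hsep : ∀ θ ∈ HalfSpaceModel.cube ν, h θ = ∑ j, hj j (θ j))
    (hcrit : ∀ j, (HalfSpaceModel.criticalSet (hj j)).Finite) :
    HalfSpaceModel.HasPurelyACSpectrum (HalfSpaceModel.H0 h hsmooth.continuousOn) ∧
    HalfSpaceModel.HasPurelyACSpectrum (HalfSpaceModel.H0plus h hsmooth.continuousOn) ∧
    spectrum ℂ (HalfSpaceModel.H0 h hsmooth.continuousOn) =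
      Complex.ofReal '' Set.Icc (HalfSpaceModel.Eminus hj) (HalfSpaceModel.Eplus hj) ∧
    Complex.ofReal '' Set.Icc (-2 + HalfSpaceModel.Eminus hj) (2 + HalfSpaceModel.Eplus hj) ⊆
      spectrum ℂ (HalfSpaceModel.H0plus h hsmooth.continuousOn) := by
  have hjs : ∀ j, ContDiffOn ℝ 1 (hj j) HalfSpaceModel.circleInterval :=
    HalfSpaceModel.contDiffOn_of_separable
      (hsmooth.of_le (by exact_mod_cast (by omega : 1 ≤ 3 * ν + 3))) hsep
  have himage := HalfSpaceModel.image_cube_eq_Icc hsmooth.continuousOn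
    (fun j => (hjs j).continuousOn) hsep
  refine ⟨?_, HalfSpaceModel.hasPurelyACSpectrum_H0plus _, ?_, ?_⟩
  · obtain ⟨k, rfl⟩ : ∃ k, ν = k + 1 := ⟨ν - 1, by omega⟩
    refine HalfSpaceModel.hasPurelyACSpectrum_H0 _
      (HalfSpaceModel.torusMeasure_preimage_eq_zero hsmooth.continuousOn (hjs 0).continuousOn
        (fun φ => ∑ j, hj j.succ (φ j)) (fun θ hθ => ?_)
        fun N hN => HalfSpaceModel.volume_preimage_eq_zero (hjs 0) (hcrit 0) hN)
    rw [hsep θ hθ, Fin.sum_univ_succ]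
    rfl
  · rw [HalfSpaceModel.spectrum_H0, himage]
  · exact (Set.image_mono (HalfSpaceModel.Icc_subset_image_bulkSymbol himage)).trans
      (HalfSpaceModel.image_bulkSymbol_subset_spectrum _)
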